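/- An \emph{edge-weighted tree} is a finite tree $T$ with a positive weight on each edge; $d_T(x,y)$ denotes the total weight of the path from $x$ to $y$ in $T$. Let $K\subseteq V(T)$ be a set of terminals and $\alpha\ge 1$. A \emph{non-Steiner tree cover} of $K$ of size $\beta$ and stretch $\alpha$ is a family $T_1,\dots,T_\beta$ of edge-weighted trees such that $V(T_i)=K$ for every $i$; $d_{T_i}(x,y)\ge d_T(x,y)$ for every $i$ and all $x,y\in K$; and for all $x,y\in K$ there is an $i$ with $d_{T_i}(x,y)\le\alpha\, d_T(x,y)$. \textbf{Theorem.} There are absolute constants $C,c>0$ such that the following hold. \begin{enumerate} \item (Stretch $2+\varepsilon$.) For every $\varepsilon\in(0,1)$, every edge-weighted tree $T$ and every $K\subseteq V(T)$, there is a non-Steiner tree cover of $K$ of stretch $2+\varepsilon$ and size at most $C\varepsilon^{-2}(1+\log\varepsilon^{-1})$; that is, of size $O(\varepsilon^{-2}\log\varepsilon^{-1})$ as $\varepsilon\to0$, independently of $T$ and $K$. \item (Stretch $2$.) For every edge-weighted tree $T$ and every $K\subseteq V(T)$ with $n=|K|\ge 2$, there is a non-Steiner tree cover of $K$ of stretch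 $2$ and size at most $C\log n$. Conversely, for every integer $n\ge1$ and every real $M\ge n$, let $T$ be the comb graph, that is, a path on $n$ vertices with edges of weight $1$ together with, for each path vertex, a new vertex joined to it by an edge of weight $M$, and let $K$ be the set of the $n$ new vertices. Then every non-Steiner tree cover of $K$ of stretch $2$ has size at least $c\log n$. \item (Stretch $2-\varepsilon$.) For every $\varepsilon\in(0,1)$, every edge-weighted tree $T$ and every $K\subseteq V(T)$ with $n=|K|$, there is a non-Steiner tree cover of $K$ of stretch $2-\varepsilon$ and size at most $Cn$. Conversely, for every $\varepsilon\in(0,1)$ and every integer $n\ge1$ there are an edge-weighted tree $T$ with $n+1$ vertices and a set $K\subseteq V(T)$ of $n$ terminals such that every non-Steiner tree cover of $K$ of stretch $2-\varepsilon$ has size at least $cn$. \end{enumerate} -/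

import Mathlib

/-- An edge-weighted tree with vertex set `V`: a tree together with a positive weight on each edge
(the values of `weight` off the edge set are irrelevant). -/
structure WeightedTree (V : Type*) where
  graph : SimpleGraph V
  isTree : graph.IsTree
  weight : Sym2 V → ℝ
  weight_pos : ∀ e ∈ graph.edgeSet, 0 < weight e

/-- The tree distance `d_T(x, y)`: the total weight of the unique path from `x` to `y`. -/
noncomputable def WeightedTree.dist {V : Type*} (T : WeightedTree V) (x y : V) : ℝ :=
  ((T.isTree.existsUnique_path x y).choose.edges.map T.weight).sum

/-- The family `F` of `β` edge-weighted trees is a non-Steiner tree cover of stretch `α` and size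
`β` for the terminals `K` in `T`.  The vertex set of every `F i` is exactly `K` (no Steiner
points). -/
structure IsNonSteinerTreeCover {V : Type*} (T : WeightedTree V) (K : Finset V) (α : ℝ) {β : ℕ}
    (F : Fin β → WeightedTree K) : Prop where
  dominating : ∀ (i : Fin β) (x y : K), T.dist x y ≤ (F i).dist x y
  low_stretch : ∀ x y : K, ∃ i : Fin β, (F i).dist x y ≤ α * T.dist x y

/-- The terminals `K` in `T` have a non-Steiner tree cover of stretch `α` with `β` trees. -/
def HasNonSteinerTreeCover {V : Type*} (T : WeightedTree V) (K : Finset V) (α : ℝ) (β : ℕ) :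
    Prop :=
  ∃ F : Fin β → WeightedTree K, IsNonSteinerTreeCover T K α F

/-- The comb graph: a path on the `n` vertices `Sum.inl i`, and for each `i` a further vertex
`Sum.inr i` attached to `Sum.inl i`. -/
def combGraph (n : ℕ) : SimpleGraph (Fin n ⊕ Fin n) where
  Adj
    | Sum.inl i, Sum.inl j => (SimpleGraph.pathGraph n).Adj i j
    | Sum.inl i, Sum.inr j => i = j
    | Sum.inr i, Sum.inl j => i = j
    | Sum.inr _, Sum.inr _ => False
  symm := ⟨by
    rintro (i | i) (j | j) h
    · exact SimpleGraph.Adj.symm h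
    · exact Eq.symm h
    · exact Eq.symm h
    · exact h⟩
  loopless := ⟨by
    rintro (i | i) h
    · exact (SimpleGraph.pathGraph n).irrefl h
    · exact h⟩

/-- `T` is the comb graph with weight `1` on the path edges and weight `M` on the attached edges. -/
structure IsWeightedComb {n : ℕ} (M : ℝ) (T : WeightedTree (Fin n ⊕ Fin n)) : Prop where
  graph_eq : T.graph = combGraph n
  weight_path : ∀ i j : Fin n, (SimpleGraph.pathGraph n).Adj i j →
    T.weight s(Sum.inl i, Sum.inl j) = 1
  weight_tooth : ∀ i : Fin n, T.weight s(Sum.inl i, Sum.inr i) = M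

/-- The `n` attached vertices of the comb graph. -/
def combTeeth (n : ℕ) : Finset (Fin n ⊕ Fin n) :=
  Finset.univ.map Function.Embedding.inr

/-! Upper bounds. Trees on `K` come from parent functions that increase a rank. Every edge is as
long as the distance in `T` of its ends, so such trees dominate. Distances are read off Gromov
products at a root, the depths of branching points; `min_gromov_le` is their ultrametric inequality.

Stretch 2: the star around the terminal nearest to a centroid serves all pairs that the centroid
separates, and the parts recurse in parallel (`exists_star_maps`).

Stretch 2 + ε: at resolution δ, cut `T` at the depths kδ + mδℤ and send the terminals of one band
below one cut point to the shallowest of them, their hub. If the branching point of x and y is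
between δ and 2δ below a cut and their distance d is at most (m - 3)δ, the route through the hub
costs 2d + O(δ). Resolutions spaced by a factor of at least 2m + 1 fit into one tree
(`exists_spanning_of_resolutions`). With m of order ε⁻², the m offsets and two interleaved sequences
of resolutions give O(ε⁻²) trees, without a logarithm.

Lower bounds. The terminal distances are nearly equal, so small stretch forces paths of one or two
edges. In the star only edges serve, and edges are counted. In the comb a pair gets weight 1/|i -
j|: the total is at least n log n, while one tree serves O(n) (`log_le_of_parentServes`). -/

namespace WeightedTree

/-! ### Tree distance as a metric. -/

variable {V : Type*} (T : WeightedTree V)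

/-- The total weight of a walk, with multiplicities. -/
noncomputable def walkWeight {x y : V} (p : T.graph.Walk x y) : ℝ :=
  (p.edges.map T.weight).sum

@[simp]
theorem walkWeight_nil (x : V) : T.walkWeight (SimpleGraph.Walk.nil : T.graph.Walk x x) = 0 := by
  simp [walkWeight]

@[simp]
theorem walkWeight_cons {x y z : V} (h : T.graph.Adj x y) (p : T.graph.Walk y z) :
    T.walkWeight (.cons h p) = T.weight s(x, y) + T.walkWeight p := by
  simp [walkWeight]

theorem walkWeight_append {x y z : V} (p : T.graph.Walk x y) (q : T.graph.Walk y z) :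
    T.walkWeight (p.append q) = T.walkWeight p + T.walkWeight q := by
  simp [walkWeight]

theorem walkWeight_reverse {x y : V} (p : T.graph.Walk x y) :
    T.walkWeight p.reverse = T.walkWeight p := by
  simp [walkWeight, List.sum_reverse]

theorem weight_pos_of_adj {x y : V} (h : T.graph.Adj x y) : 0 < T.weight s(x, y) :=
  T.weight_pos _ h

theorem dist_eq_walkWeight {x y : V} {p : T.graph.Walk x y} (hp : p.IsPath) :
    T.dist x y = T.walkWeight p := by
  have h := T.isTree.existsUnique_path x y
  rw [← h.unique h.choose_spec.1 hp]
  rfl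

theorem exists_isPath (x y : V) : ∃ p : T.graph.Walk x y, p.IsPath :=
  (T.isTree.existsUnique_path x y).exists

theorem dist_le_walkWeight {x y : V} (p : T.graph.Walk x y) : T.dist x y ≤ T.walkWeight p := by
  classical
  rw [T.dist_eq_walkWeight p.bypass_isPath]
  refine List.Sublist.sum_le_sum (p.edges_bypass_sublist_edges.map _) ?_
  intro w hw
  obtain ⟨e, he, rfl⟩ := List.mem_map.1 hw
  exact (T.weight_pos e (p.edges_subset_edgeSet he)).le

@[simp]
theorem dist_self (x : V) : T.dist x x = 0 := by
  rw [T.dist_eq_walkWeight (SimpleGraph.Walk.IsPath.nil : (SimpleGraph.Walk.nil' x).IsPath)]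
  exact T.walkWeight_nil x

theorem dist_comm (x y : V) : T.dist x y = T.dist y x := by
  obtain ⟨p, hp⟩ := T.exists_isPath x y
  rw [T.dist_eq_walkWeight hp, T.dist_eq_walkWeight hp.reverse, walkWeight_reverse]

theorem dist_triangle (x y z : V) : T.dist x z ≤ T.dist x y + T.dist y z := by
  obtain ⟨p, hp⟩ := T.exists_isPath x y
  obtain ⟨q, hq⟩ := T.exists_isPath y z
  rw [T.dist_eq_walkWeight hp, T.dist_eq_walkWeight hq, ← walkWeight_append]
  exact T.dist_le_walkWeight _

theorem dist_eq_weight {x y : V} (h : T.graph.Adj x y) : T.dist x y = T.weight s(x, y) := by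
  rw [T.dist_eq_walkWeight (SimpleGraph.Walk.IsPath.of_adj h)]
  simp [SimpleGraph.Adj.toWalk]

theorem walkWeight_nonneg {x y : V} (p : T.graph.Walk x y) : 0 ≤ T.walkWeight p := by
  induction p with
  | nil => simp
  | cons h p ih =>
    rw [walkWeight_cons]
    linarith [T.weight_pos_of_adj h]

theorem dist_nonneg (x y : V) : 0 ≤ T.dist x y := by
  obtain ⟨p, hp⟩ := T.exists_isPath x y
  rw [T.dist_eq_walkWeight hp]
  exact T.walkWeight_nonneg p

theorem dist_pos {x y : V} (hxy : x ≠ y) : 0 < T.dist x y := by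
  obtain ⟨p, hp⟩ := T.exists_isPath x y
  rw [T.dist_eq_walkWeight hp]
  cases p with
  | nil => exact absurd rfl hxy
  | cons h p =>
    rw [walkWeight_cons]
    linarith [T.weight_pos_of_adj h, T.walkWeight_nonneg p]

theorem sub_le_walkWeight {φ : V → ℝ} (hφ : ∀ u v, T.graph.Adj u v → φ v - φ u ≤ T.weight s(u, v))
    {x y : V} (p : T.graph.Walk x y) : φ y - φ x ≤ T.walkWeight p := by
  induction p with
  | nil => simp
  | cons h p ih =>
    rw [walkWeight_cons]
    linarith [hφ _ _ h]

/-- Lower bounds on distances in spanning trees, stars and combs are obtained by exhibiting a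
potential `φ`. -/
theorem sub_le_dist {φ : V → ℝ} (hφ : ∀ u v, T.graph.Adj u v → φ v - φ u ≤ T.weight s(u, v))
    (x y : V) : φ y - φ x ≤ T.dist x y := by
  obtain ⟨p, hp⟩ := T.exists_isPath x y
  rw [T.dist_eq_walkWeight hp]
  exact T.sub_le_walkWeight hφ p

/-! ### Points on paths, medians and Gromov products. -/

theorem dist_add_dist_of_mem_support {x y z : V} {p : T.graph.Walk x y} (hp : p.IsPath)
    (hz : z ∈ p.support) : T.dist x z + T.dist z y = T.dist x y := by
  classical
  rw [T.dist_eq_walkWeight hp, T.dist_eq_walkWeight (hp.takeUntil hz),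
    T.dist_eq_walkWeight (hp.dropUntil hz), ← walkWeight_append, p.take_spec]

/-- The last clause serves the induction on `q`: it ensures that the path extended by a new vertex
is still a path. -/
theorem exists_median_aux {x y r : V} (p : T.graph.Walk x r) (hp : p.IsPath) (q : T.graph.Walk y r)
    (hq : q.IsPath) : ∃ m ∈ p.support, m ∈ q.support ∧ ∃ s : T.graph.Walk x y, s.IsPath ∧
      m ∈ s.support ∧ ∀ v ∈ s.support, v ∈ p.support ∨ v ∈ q.support := by
  classical
  induction q with
  | nil => exact ⟨_, p.end_mem_support, by simp, p, hp, p.end_mem_support, fun v hv => .inl hv⟩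
  | @cons y y' r h q ih =>
    by_cases hy : y ∈ p.support
    · exact ⟨y, hy, by simp, p.takeUntil y hy, hp.takeUntil hy, by simp,
        fun v hv => .inl (p.support_takeUntil_subset_support hy hv)⟩
    · rw [SimpleGraph.Walk.cons_isPath_iff] at hq
      obtain ⟨m, hmp, hmq, s, hs, hms, hsub⟩ := ih p hp hq.1
      refine ⟨m, hmp, by simp [hmq], s.concat h.symm, hs.concat ?_ h.symm, ?_, ?_⟩
      · intro hys
        exact (hsub y hys).elim hy hq.2
      · simp [SimpleGraph.Walk.support_concat, hms]
      · intro v hv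
        simp only [SimpleGraph.Walk.support_concat, List.mem_append,
          SimpleGraph.Walk.support_cons, List.mem_cons, List.not_mem_nil, or_false] at hv ⊢
        rcases hv with hv | rfl
        · have := hsub v hv
          tauto
        · tauto

/-- The Gromov product of `x` and `y` based at `r`: the distance from `r` to the point where the
paths to `x` and to `y` part. -/
noncomputable def gromov (r x y : V) : ℝ :=
  (T.dist r x + T.dist r y - T.dist x y) / 2

theorem gromov_comm (r x y : V) : T.gromov r x y = T.gromov r y x := by
  rw [gromov, gromov, T.dist_comm x y]
  ring

@[simp]
theorem gromov_self (r x : V) : T.gromov r x x = T.dist r x := by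
  simp [gromov]

theorem dist_eq_gromov (r x y : V) :
    T.dist x y = T.dist r x + T.dist r y - 2 * T.gromov r x y := by
  rw [gromov]
  ring

theorem gromov_le_left (r x y : V) : T.gromov r x y ≤ T.dist r x := by
  rw [gromov]
  linarith [T.dist_triangle r x y]

theorem gromov_le_right (r x y : V) : T.gromov r x y ≤ T.dist r y := by
  rw [gromov_comm]
  exact T.gromov_le_left r y x

/-- Of two points on a path to `r`, the one nearer to `r` lies between `r` and the other. -/
theorem dist_add_dist_of_mem_support_of_le {r y a b : V} {q : T.graph.Walk y r} (hq : q.IsPath)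
    (ha : a ∈ q.support) (hb : b ∈ q.support) (hab : T.dist r a ≤ T.dist r b) :
    T.dist r a + T.dist a b = T.dist r b := by
  classical
  have h1 := T.dist_add_dist_of_mem_support hq ha
  have h2 := T.dist_add_dist_of_mem_support hq hb
  rw [T.dist_comm r a, T.dist_comm r b] at *
  have hc := T.dist_comm a b
  have ha' := ha
  rw [← q.take_spec hb, SimpleGraph.Walk.mem_support_append_iff] at ha'
  rcases ha' with h | h
  · have := T.dist_add_dist_of_mem_support (hq.takeUntil hb) h
    have h0 := T.dist_nonneg a b
    linarith
  · have := T.dist_add_dist_of_mem_support (hq.dropUntil hb) h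
    linarith

theorem exists_gromov_median {r x y : V} {p : T.graph.Walk x r} (hp : p.IsPath)
    {q : T.graph.Walk y r} (hq : q.IsPath) : ∃ m ∈ p.support, m ∈ q.support ∧
      T.dist r m = T.gromov r x y := by
  obtain ⟨m, hmp, hmq, s, hs, hms, -⟩ := T.exists_median_aux p hp q hq
  refine ⟨m, hmp, hmq, ?_⟩
  have h1 := T.dist_add_dist_of_mem_support hp hmp
  have h2 := T.dist_add_dist_of_mem_support hq hmq
  have h3 := T.dist_add_dist_of_mem_support hs hms
  rw [T.dist_comm m r, T.dist_comm x r] at h1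
  rw [T.dist_comm y m, T.dist_comm m r, T.dist_comm y r] at h2
  rw [gromov]
  linarith

/-- A weighted tree is a `0`-hyperbolic metric space. -/
theorem min_gromov_le (r x y z : V) :
    min (T.gromov r x y) (T.gromov r y z) ≤ T.gromov r x z := by
  wlog h : T.gromov r x y ≤ T.gromov r y z generalizing x z
  · have := this z x (by rw [T.gromov_comm r z y, T.gromov_comm r y x]; exact (not_le.1 h).le)
    rwa [T.gromov_comm r z x, T.gromov_comm r z y, T.gromov_comm r y x, min_comm] at this
  rw [min_eq_left h]
  obtain ⟨p, hp⟩ := T.exists_isPath x r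
  obtain ⟨q, hq⟩ := T.exists_isPath y r
  obtain ⟨s, hs⟩ := T.exists_isPath z r
  -- Both medians lie on the path from `y` to `r`, `m` being the shallower; the route from `x`
  -- through `m` and `m'` to `z` gives the bound.
  obtain ⟨m, hmp, hmq, hm⟩ := T.exists_gromov_median hp hq
  obtain ⟨m', hmq', hms, hm'⟩ := T.exists_gromov_median hq hs
  rw [← hm, ← hm'] at h
  have h1 := T.dist_add_dist_of_mem_support_of_le hq hmq hmq' h
  have h2 := T.dist_add_dist_of_mem_support hp hmp
  have h3 := T.dist_add_dist_of_mem_support hs hms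
  have h4 := T.dist_triangle x m z
  have h5 := T.dist_triangle m m' z
  rw [T.dist_comm m r, T.dist_comm x r] at h2
  rw [T.dist_comm z m', T.dist_comm m' r, T.dist_comm z r] at h3
  rw [← hm, gromov]
  linarith

theorem le_gromov_trans {r x y z : V} {t : ℝ} (hxy : t ≤ T.gromov r x y)
    (hyz : t ≤ T.gromov r y z) : t ≤ T.gromov r x z :=
  (le_min hxy hyz).trans (T.min_gromov_le r x y z)

end WeightedTree

/-! ### Spanning trees from parent functions. -/

/-- The graph joining each vertex `v` to `p v`. -/
def parentGraph {V : Type*} (p : V → V) : SimpleGraph V :=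
  SimpleGraph.fromRel fun x y => y = p x

theorem parentGraph_adj {V : Type*} {p : V → V} {x y : V} :
    (parentGraph p).Adj x y ↔ x ≠ y ∧ (y = p x ∨ x = p y) := by
  simp [parentGraph]

theorem rank_le_rank_iterate {V R : Type*} [Preorder R] {p : V → V} {rank : V → R}
    (h : ∀ v, p v ≠ v → rank v < rank (p v)) (v : V) (k : ℕ) : rank v ≤ rank (p^[k] v) := by
  induction k with
  | zero => exact le_rfl
  | succ k ih =>
    rw [Function.iterate_succ_apply']
    by_cases hk : p (p^[k] v) = p^[k] v
    · rwa [hk]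
    · exact ih.trans (h _ hk).le

/-- Every edge from `v` to `p v` is a bridge: without it, the set of vertices whose orbit under `p`
reaches `v` is closed under adjacency, and `p v` is not in it because its rank exceeds that of `v`.
-/
theorem isAcyclic_parentGraph {V R : Type*} [Preorder R] {p : V → V} (rank : V → R)
    (h : ∀ v, p v ≠ v → rank v < rank (p v)) : (parentGraph p).IsAcyclic := by
  have key : ∀ v, p v ≠ v → (parentGraph p).IsBridge s(v, p v) := by
    intro v hv
    rw [SimpleGraph.isBridge_iff]
    rintro ⟨w⟩
    have closed : ∀ {a b : V} (w : ((parentGraph p).deleteEdges {s(v, p v)}).Walk a b),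
        (∃ k, p^[k] a = v) → ∃ k, p^[k] b = v := by
      intro a b w
      induction w with
      | nil => exact id
      | @cons a c b hac w ih =>
        rintro ⟨k, hk⟩
        apply ih
        rw [SimpleGraph.deleteEdges_adj, parentGraph_adj] at hac
        obtain ⟨⟨hne, hp⟩, hnot⟩ := hac
        rcases hp with rfl | rfl
        · cases k with
          | zero =>
            rw [Function.iterate_zero_apply] at hk
            subst hk
            exact absurd rfl hnot
          | succ k => exact ⟨k, by rwa [Function.iterate_succ_apply] at hk⟩
        · exact ⟨k + 1, by rwa [Function.iterate_succ_apply]⟩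
    obtain ⟨k, hk⟩ := closed w ⟨0, rfl⟩
    have h1 := rank_le_rank_iterate h (p v) k
    rw [hk] at h1
    exact lt_irrefl _ ((h v hv).trans_le h1)
  rw [SimpleGraph.isAcyclic_iff_forall_adj_isBridge]
  intro x y hxy
  rw [parentGraph_adj] at hxy
  obtain ⟨hne, rfl | rfl⟩ := hxy
  · exact key x hne.symm
  · rw [Sym2.eq_swap]
    exact key y hne

namespace WeightedTree

variable {V : Type*} (T : WeightedTree V)

/-- A spanning tree on the terminals, each edge weighted by its length in `T`. -/
noncomputable def ofSpanning {K : Finset V} {G : SimpleGraph K} (hG : G.IsTree) :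
    WeightedTree K where
  graph := G
  isTree := hG
  weight := Sym2.lift ⟨fun x y => T.dist x y, fun x y => T.dist_comm x y⟩
  weight_pos e := by
    induction e using Sym2.ind with
    | _ x y =>
      intro h
      exact T.dist_pos fun hxy => h.ne (Subtype.ext hxy)

theorem dist_le_ofSpanning_dist {K : Finset V} {G : SimpleGraph K} (hG : G.IsTree) (x y : K) :
    T.dist x y ≤ (T.ofSpanning hG).dist x y := by
  have := (T.ofSpanning hG).sub_le_dist (φ := fun u : K => T.dist x u) (fun u v _ => by
    have := T.dist_triangle x u v
    change T.dist x v - T.dist x u ≤ T.dist u v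
    linarith) x y
  simpa using this

/-- A parent function on the terminals extends to a dominating spanning tree in which the step from
a terminal to its parent costs no more than in `T`. -/
theorem exists_spanning_of_parent {R : Type*} [Preorder R] {K : Finset V} [Nonempty K]
    {p : K → K} (rank : K → R) (h : ∀ v, p v ≠ v → rank v < rank (p v)) :
    ∃ F : WeightedTree K, (∀ x y : K, T.dist x y ≤ F.dist x y) ∧
      ∀ x : K, F.dist x (p x) ≤ T.dist x (p x) := by
  obtain ⟨G, hle, -, hG⟩ := SimpleGraph.connected_top.exists_isTree_le_of_le_of_isAcyclic
    le_top (isAcyclic_parentGraph rank h)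
  refine ⟨T.ofSpanning hG, T.dist_le_ofSpanning_dist hG, fun x => ?_⟩
  by_cases hx : p x = x
  · simp [hx]
  · have : (T.ofSpanning hG).graph.Adj x (p x) :=
      hle (parentGraph_adj.2 ⟨Ne.symm hx, .inl rfl⟩)
    rw [dist_eq_weight _ this]
    exact le_rfl

/-- An idempotent map yields a star forest. -/
theorem exists_spanning_of_idempotent {K : Finset V} [Nonempty K] {f : K → K}
    (hf : ∀ x, f (f x) = f x) :
    ∃ F : WeightedTree K, (∀ x y : K, T.dist x y ≤ F.dist x y) ∧
      ∀ x y : K, f x = f y → F.dist x y ≤ T.dist x (f x) + T.dist (f x) y := by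
  classical
  obtain ⟨F, hF, hp⟩ := T.exists_spanning_of_parent (p := f)
    (fun x => if f x = x then (1 : ℕ) else 0) (fun v hv => by simp [hv, hf])
  refine ⟨F, hF, fun x y hxy => (F.dist_triangle x (f x) y).trans (add_le_add (hp x) ?_)⟩
  rw [F.dist_comm, T.dist_comm, hxy]
  exact hp y

end WeightedTree

theorem HasNonSteinerTreeCover.of_forall {V ι : Type*} [Fintype ι] {T : WeightedTree V}
    {K : Finset V} {α : ℝ} (P : K → K → ι → Prop)
    (h : ∀ i, ∃ F : WeightedTree K, (∀ x y : K, T.dist x y ≤ F.dist x y) ∧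
      ∀ x y, P x y i → F.dist x y ≤ α * T.dist x y)
    (hP : ∀ x y, ∃ i, P x y i) : HasNonSteinerTreeCover T K α (Fintype.card ι) := by
  choose F hF hα using h
  refine ⟨fun i => F ((Fintype.equivFin ι).symm i), fun i => hF _, fun x y => ?_⟩
  obtain ⟨i, hi⟩ := hP x y
  exact ⟨Fintype.equivFin ι i, by simpa using hα i x y hi⟩

theorem HasNonSteinerTreeCover.of_isEmpty {V : Type*} {T : WeightedTree V} {α : ℝ} :
    HasNonSteinerTreeCover T ∅ α 0 :=
  ⟨fun i => i.elim0, fun i => i.elim0, fun x => absurd x.2 (Finset.notMem_empty _)⟩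

/-- The stars around the terminals cover all distances exactly. -/
theorem hasNonSteinerTreeCover_card {V : Type*} (T : WeightedTree V) (K : Finset V) {α : ℝ}
    (hα : 1 ≤ α) : HasNonSteinerTreeCover T K α K.card := by
  have := HasNonSteinerTreeCover.of_forall (T := T) (K := K) (α := α) (ι := K)
    (fun x _ i => i = x) (fun i => ?_) (fun x _ => ⟨x, rfl⟩)
  · rwa [Fintype.card_coe] at this
  · have : Nonempty K := ⟨i⟩
    obtain ⟨F, hF, hs⟩ := T.exists_spanning_of_idempotent (f := fun _ : K => i) (fun _ => rfl)
    refine ⟨F, hF, ?_⟩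
    rintro x y rfl
    have h1 := hs i y rfl
    have h2 := T.dist_nonneg i y
    rw [T.dist_self] at h1
    nlinarith

/-! ### Centroids and the upper bound for stretch 2. -/

namespace WeightedTree

variable {V : Type*} (T : WeightedTree V)

/-- Every finite set of vertices has a centroid: a point of `T`, given by its distances `D` to the
vertices, and a partition into parts of at most half the size, such that paths between different
parts pass through that point. -/
theorem exists_centroid (S : Finset V) (hS : 2 ≤ S.card) : ∃ (D : V → ℝ) (s : Setoid V),
    (∀ x y, T.dist x y ≤ D x + D y) ∧ (∀ x y, ¬ s x y → T.dist x y = D x + D y) ∧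
    ∀ x ∈ S, ∀ A ⊆ S, (∀ y ∈ A, s x y) → 2 * A.card ≤ S.card := by
  classical
  obtain ⟨r, hr⟩ : S.Nonempty := Finset.card_pos.1 (by omega)
  have hg0 : ∀ x, T.gromov r r x = 0 := fun x => by simp [gromov]
  -- A deepest branching point below which more than half of `S` lies; the root, given by `(r, r)`,
  -- qualifies. The centroid is the point at depth `t` on the path from `r` to `z`.
  obtain ⟨⟨z, w⟩, hzw, hmax⟩ := ((S ×ˢ S).filter fun q : V × V =>
    S.card < 2 * (S.filter fun y => T.gromov r q.1 q.2 ≤ T.gromov r q.1 y).card).exists_max_image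
      (fun q => T.gromov r q.1 q.2) ⟨(r, r), by
        simp only [Finset.mem_filter, Finset.mem_product, hg0, le_refl, Finset.filter_true]
        exact ⟨⟨hr, hr⟩, by omega⟩⟩
  simp only [Finset.mem_filter, Finset.mem_product, and_imp, Prod.forall] at hzw hmax
  obtain ⟨⟨hz, hw⟩, hcard⟩ := hzw
  set t := T.gromov r z w
  have htrans : ∀ x y u, min (T.gromov r x y) (T.gromov r y u) ≤ T.gromov r x u :=
    T.min_gromov_le r
  have hcomm : ∀ x y, T.gromov r x y = T.gromov r y x := T.gromov_comm r
  -- The parts are the branches below the centroid and the set of all vertices not below it. The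
  -- alternative `x = y` gives reflexivity at a vertex that is the centroid itself.
  refine ⟨fun x => T.dist r x + t - 2 * min t (T.gromov r z x),
    ⟨fun x y => x = y ∨ t < T.gromov r x y ∨ (T.gromov r z x < t ∧ T.gromov r z y < t),
      ⟨fun x => .inl rfl, ?_, ?_⟩⟩, ?_, ?_, ?_⟩
  · rintro x y (h | h | h)
    · exact .inl h.symm
    · exact .inr (.inl (by rwa [hcomm]))
    · exact .inr (.inr h.symm)
  · rintro x y u (rfl | h | h) (rfl | h' | h')
    · exact .inl rfl
    · exact .inr (.inl h')
    · exact .inr (.inr h')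
    · exact .inr (.inl h)
    · exact .inr (.inl ((lt_min h h').trans_le (htrans x y u)))
    · refine .inr (.inr ⟨?_, h'.2⟩)
      by_contra! hx
      exact absurd ((le_min hx h.le).trans (htrans z x y)) (not_le.2 h'.1)
    · exact .inr (.inr h)
    · refine .inr (.inr ⟨h.1, ?_⟩)
      by_contra! hu
      rw [hcomm] at h'
      exact absurd ((le_min hu h'.le).trans (htrans z u y)) (not_le.2 h.2)
    · exact .inr (.inr ⟨h.1, h'.2⟩)
  · intro x y
    have h1 := htrans x z y
    rw [hcomm x z] at h1
    rw [T.dist_eq_gromov r]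
    rcases min_cases t (T.gromov r z x) with h2 | h2 <;>
      rcases min_cases t (T.gromov r z y) with h3 | h3 <;>
      rcases min_cases (T.gromov r z x) (T.gromov r z y) with h4 | h4 <;> linarith
  · intro x y hxy
    have hxy' : ¬ (x = y ∨ t < T.gromov r x y ∨ (T.gromov r z x < t ∧ T.gromov r z y < t)) := hxy
    push Not at hxy'
    obtain ⟨-, h, h'⟩ := hxy'
    have h1 := htrans x z y
    have h2 := htrans z x y
    have h3 := htrans z y x
    rw [hcomm x z] at h1
    rw [hcomm y x] at h3
    rw [T.dist_eq_gromov r]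
    beta_reduce
    rcases lt_or_ge (T.gromov r z x) t with hx | hx
    · have hy := h' hx
      rw [min_eq_right hx.le, min_eq_left hy]
      rw [min_eq_left (by linarith)] at h1
      rcases min_le_iff.1 h3 with h3 | h3 <;> linarith
    · rw [min_eq_left hx]
      rcases lt_or_ge (T.gromov r z y) t with hy | hy
      · rw [min_eq_right hy.le]
        rw [min_eq_right (by linarith)] at h1
        rcases min_le_iff.1 h2 with h2 | h2 <;> linarith
      · rw [min_eq_left hy]
        have := (le_min hx hy).trans h1
        linarith
  · intro x hx A hAS hA
    rcases lt_or_ge (T.gromov r z x) t with hxt | hxt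
    · have hsub : A ⊆ S.filter fun y => ¬ t ≤ T.gromov r z y := by
        intro y hy
        refine Finset.mem_filter.2 ⟨hAS hy, ?_⟩
        intro hyt
        rcases hA y hy with rfl | h | h
        · linarith
        · rw [hcomm] at h
          exact absurd ((le_min hyt h.le).trans (htrans z y x)) (not_le.2 hxt)
        · linarith [h.2]
      have h1 := Finset.card_le_card hsub
      have h2 := Finset.card_filter_add_card_filter_not (s := S) fun y => t ≤ T.gromov r z y
      omega
    · have hA' : ∀ y ∈ A, x = y ∨ t < T.gromov r x y := by
        intro y hy
        rcases hA y hy with h | h | h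
        · exact .inl h
        · exact .inr h
        · linarith [h.1]
      by_cases hone : A ⊆ {x}
      · have := Finset.card_le_card hone
        rw [Finset.card_singleton] at this
        omega
      have hxr : t < T.dist r x := by
        obtain ⟨y, hy, hyx⟩ := Finset.not_subset.1 hone
        rcases hA' y hy with rfl | h
        · simp at hyx
        · exact h.trans_le (T.gromov_le_left r x y)
      have hA2 : ∀ y ∈ A, t < T.gromov r x y := by
        intro y hy
        rcases hA' y hy with rfl | h
        · rwa [gromov_self]
        · exact h
      -- All of `A` lies below the branching point of `x` and `u`, which is deeper than `t`; more
      -- than half of `S` there would contradict the choice of `t`.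
      obtain ⟨u, hu, hmin⟩ := A.exists_min_image (fun y => T.gromov r x y)
        (by
          rw [Finset.nonempty_iff_ne_empty]
          rintro rfl
          simp at hone)
      by_contra! hlt
      have hsub : A ⊆ S.filter fun y => T.gromov r x u ≤ T.gromov r x y :=
        fun y hy => Finset.mem_filter.2 ⟨hAS hy, hmin y hy⟩
      have := hmax x u hx (hAS hu) (by have := Finset.card_le_card hsub; omega)
      linarith [hA2 u hu]

/-- Star forests of stretch `2`: the stars of the first forest are centred at a terminal nearest to a
centroid, the other forests treat the parts at the centroid in parallel. -/
theorem exists_star_maps (m : ℕ) : ∀ S : Finset V, S.card ≤ 2 ^ m → ∃ f : ℕ → V → V,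
    (∀ j, ∀ x ∈ S, f j x ∈ S ∧ f j (f j x) = f j x) ∧
    ∀ x ∈ S, ∀ y ∈ S, ∃ j ≤ m, f j x = f j y ∧
      T.dist x (f j x) + T.dist (f j x) y ≤ 2 * T.dist x y := by
  classical
  have hsmall : ∀ (m : ℕ) (S : Finset V), S.card ≤ 1 → ∃ f : ℕ → V → V,
      (∀ j, ∀ x ∈ S, f j x ∈ S ∧ f j (f j x) = f j x) ∧
      ∀ x ∈ S, ∀ y ∈ S, ∃ j ≤ m, f j x = f j y ∧
        T.dist x (f j x) + T.dist (f j x) y ≤ 2 * T.dist x y := by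
    intro m S hS
    refine ⟨fun _ => id, fun _ x hx => ⟨hx, rfl⟩, fun x hx y hy => ⟨0, Nat.zero_le _, ?_⟩⟩
    obtain rfl := Finset.card_le_one.1 hS x hx y hy
    simp
  induction m with
  | zero => exact fun S hS => hsmall 0 S hS
  | succ m ih =>
    intro S hS
    by_cases h1 : S.card ≤ 1
    · exact hsmall _ S h1
    obtain ⟨D, s, hD, hsep, hhalf⟩ := T.exists_centroid S (by omega)
    obtain ⟨c, hc, hcmin⟩ := S.exists_min_image D (Finset.card_pos.1 (by omega))
    have hpart : ∀ x ∈ S, (S.filter fun y => s x y).card ≤ 2 ^ m := by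
      intro x hx
      have := hhalf x hx (S.filter fun y => s x y) (Finset.filter_subset _ _)
        fun y hy => (Finset.mem_filter.1 hy).2
      rw [pow_succ] at hS
      omega
    -- Choosing maps for every finite set, junk ones for large sets, makes them depend only on the
    -- part and not on the point representing it.
    have hex : ∀ A : Finset V, ∃ f : ℕ → V → V, A.card ≤ 2 ^ m →
        (∀ j, ∀ x ∈ A, f j x ∈ A ∧ f j (f j x) = f j x) ∧
        ∀ x ∈ A, ∀ y ∈ A, ∃ j ≤ m, f j x = f j y ∧
          T.dist x (f j x) + T.dist (f j x) y ≤ 2 * T.dist x y := by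
      intro A
      by_cases hA : A.card ≤ 2 ^ m
      · obtain ⟨f, hf⟩ := ih A hA
        exact ⟨f, fun _ => hf⟩
      · exact ⟨fun _ => id, fun h => absurd h hA⟩
    choose f hf using hex
    have hmem : ∀ x ∈ S, x ∈ S.filter fun y => s x y :=
      fun x hx => Finset.mem_filter.2 ⟨hx, s.refl x⟩
    have hcongr : ∀ x y, s x y → (S.filter fun u => s x u) = S.filter fun u => s y u := by
      intro x y hxy
      refine Finset.filter_congr fun u _ => ⟨fun h => s.trans (s.symm hxy) h, fun h => s.trans hxy h⟩
    refine ⟨fun j x => j.casesOn c fun j => f (S.filter fun y => s x y) j x, ?_, ?_⟩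
    · rintro (_ | j) x hx
      · exact ⟨hc, rfl⟩
      · have h2 := (hf _ (hpart x hx)).1 j x (hmem x hx)
        have h3 := Finset.mem_filter.1 h2.1
        refine ⟨h3.1, ?_⟩
        change f (S.filter fun y => s (f (S.filter fun y => s x y) j x) y) j
          (f (S.filter fun y => s x y) j x) = f (S.filter fun y => s x y) j x
        rw [← hcongr _ _ h3.2]
        exact h2.2
    · intro x hx y hy
      by_cases hxy : s x y
      · obtain ⟨j, hj, h2⟩ := (hf _ (hpart x hx)).2 x (hmem x hx) y (Finset.mem_filter.2 ⟨hy, hxy⟩)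
        refine ⟨j + 1, by omega, ?_, h2.2⟩
        change f (S.filter fun u => s x u) j x = f (S.filter fun u => s y u) j y
        rw [← hcongr _ _ hxy]
        exact h2.1
      · refine ⟨0, Nat.zero_le _, rfl, ?_⟩
        -- The route through `c` costs at most `D x + 2 * D c + D y`, and `D c` is at most `D x` and
        -- `D y`.
        have h2 := hsep x y hxy
        have h3 := hD x c
        have h4 := hD c y
        have h5 := hcmin x hx
        have h6 := hcmin y hy
        change T.dist x c + T.dist c y ≤ _
        linarith

end WeightedTree

theorem hasNonSteinerTreeCover_two {V : Type*} (T : WeightedTree V) (K : Finset V) {m : ℕ}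
    (hK : K.Nonempty) (hm : K.card ≤ 2 ^ m) : HasNonSteinerTreeCover T K 2 (m + 1) := by
  obtain ⟨f, hf, hcov⟩ := T.exists_star_maps m K hm
  have : Nonempty K := hK.to_subtype
  have := HasNonSteinerTreeCover.of_forall (T := T) (K := K) (α := 2) (ι := Fin (m + 1))
    (fun x y j => f j x = f j y ∧ T.dist x (f j x) + T.dist (f j x) y ≤ 2 * T.dist x y)
    (fun j => ?_) (fun x y => ?_)
  · rwa [Fintype.card_fin] at this
  · obtain ⟨F, hF, hs⟩ := T.exists_spanning_of_idempotent
      (f := fun x : K => ⟨f j x, (hf j x x.2).1⟩) (fun x => Subtype.ext (hf j x x.2).2)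
    exact ⟨F, hF, fun x y hxy => (hs x y (Subtype.ext hxy.1)).trans hxy.2⟩
  · obtain ⟨j, hj, h⟩ := hcov x x.2 y y.2
    exact ⟨⟨j, by omega⟩, h⟩

/-- With `m + 1 = Nat.log 2 n + 2`, at most three times the binary logarithm of `n`, the constant 5
suffices because 3 / log 2 < 5. -/
theorem exists_card_le_two_pow {n : ℕ} (hn : 2 ≤ n) :
    ∃ m : ℕ, n ≤ 2 ^ m ∧ ((m + 1 : ℕ) : ℝ) ≤ 5 * Real.log n := by
  refine ⟨Nat.log 2 n + 1, (Nat.lt_pow_succ_log_self one_lt_two n).le, ?_⟩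
  have h1 : (Nat.log 2 n : ℝ) * Real.log 2 ≤ Real.log n := by
    rw [← Real.log_pow]
    exact Real.log_le_log (by positivity) (by exact_mod_cast Nat.pow_log_le_self 2 (by omega))
  have h2 : (1 : ℝ) ≤ Nat.log 2 n := by exact_mod_cast Nat.log_pos one_lt_two hn
  have h3 := Real.log_two_gt_d9
  push_cast
  nlinarith

theorem exists_hub_map {K : Type*} [Finite K] (s : Setoid K) (h : K → ℝ) (g : K → K)
    (hg : ∀ x, g (g x) = g x) : ∃ g' : K → K, (∀ x, g (g' x) = g' x) ∧ (∀ x, g' (g' x) = g' x) ∧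
      (∀ x, g' (g x) = g' x) ∧ (∀ x, s (g x) (g' x)) ∧ (∀ x y, s (g x) (g y) → g' x = g' y) ∧
      ∀ x, h (g' x) ≤ h (g x) := by
  have hex : ∀ q : Quotient s, ∃ u : K, ∀ x, (⟦g x⟧ : Quotient s) = q →
      g u = u ∧ s (g x) u ∧ h u ≤ h (g x) := by
    intro q
    by_cases hq : ∃ x, (⟦g x⟧ : Quotient s) = q
    · obtain ⟨z, hz, hmin⟩ := Set.exists_min_image {u | g u = u ∧ (⟦u⟧ : Quotient s) = q} h
        (Set.toFinite _) (hq.imp' g fun x hx => ⟨hg x, hx⟩)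
      exact ⟨z, fun x hx => ⟨hz.1, Quotient.exact (hx.trans hz.2.symm), hmin _ ⟨hg x, hx⟩⟩⟩
    -- A class that contains no value of `g` gets an arbitrary point, never used.
    · obtain ⟨u⟩ : Nonempty K := q.inductionOn fun a => ⟨a⟩
      exact ⟨u, fun x hx => absurd ⟨x, hx⟩ hq⟩
  choose H hH using hex
  have h1 : ∀ x, g (H ⟦g x⟧) = H ⟦g x⟧ := fun x => (hH _ x rfl).1
  refine ⟨fun x => H ⟦g x⟧, h1, fun x => ?_, fun x => ?_, fun x => (hH _ x rfl).2.1,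
    fun x y hxy => ?_, fun x => (hH _ x rfl).2.2⟩
  · beta_reduce
    rw [h1, Quotient.sound (s.symm (hH _ x rfl).2.1)]
  · beta_reduce
    rw [hg]
  · beta_reduce
    rw [Quotient.sound hxy]

/-- A sequence of retractions `g i` of a finite set: `g (i + 1)` sends all points of the image of
`g i` in one class of `s i` to one of them of least height. -/
structure IsHubSequence {K : Type*} (s : ℕ → Setoid K) (h : K → ℝ) (g : ℕ → K → K) : Prop where
  zero : ∀ x, g 0 x = x
  idem : ∀ i x, g i (g i x) = g i x
  apply_succ : ∀ i x, g i (g (i + 1) x) = g (i + 1) x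
  succ_apply : ∀ i x, g (i + 1) (g i x) = g (i + 1) x
  rel : ∀ i x, s i (g i x) (g (i + 1) x)
  eq_of_rel : ∀ i x y, s i (g i x) (g i y) → g (i + 1) x = g (i + 1) y
  height_le : ∀ i x, h (g (i + 1) x) ≤ h (g i x)

theorem exists_isHubSequence {K : Type*} [Finite K] (s : ℕ → Setoid K) (h : K → ℝ) :
    ∃ g, IsHubSequence s h g := by
  choose step h1 h2 h3 h4 h5 h6 using
    fun (i : ℕ) (g : {g : K → K // ∀ x, g (g x) = g x}) => exists_hub_map (s i) h g.1 g.2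
  let G : ℕ → {g : K → K // ∀ x, g (g x) = g x} :=
    fun i => Nat.rec ⟨id, fun _ => rfl⟩ (fun i g => ⟨step i g, h2 i g⟩) i
  exact ⟨fun i => (G i).1, fun _ => rfl, fun i => (G i).2, fun i => h1 i (G i),
    fun i => h3 i (G i), fun i => h4 i (G i), fun i => h5 i (G i), fun i => h6 i (G i)⟩

namespace IsHubSequence

variable {K : Type*} {s : ℕ → Setoid K} {h : K → ℝ} {g : ℕ → K → K}

theorem apply_of_le (hg : IsHubSequence s h g) {i j : ℕ} (hij : i ≤ j) (x : K) :
    g i (g j x) = g j x := by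
  induction j, hij using Nat.le_induction generalizing x with
  | base => exact hg.idem i x
  | succ j _ ih => rw [← hg.apply_succ j x, ih]

end IsHubSequence

namespace WeightedTree

variable {V : Type*} (T : WeightedTree V)

/-- The parent of `v` is the first hub different from `v`, and the rank of `v` is the index of that
step, `⊤` if there is none. The new hub is fixed by all maps up to that step, so its rank is larger.
-/
theorem exists_spanning_of_isHubSequence {K : Finset V} [Nonempty K] {s : ℕ → Setoid K}
    {h : K → ℝ} {g : ℕ → K → K} (hg : IsHubSequence s h g) :
    ∃ F : WeightedTree K, (∀ x y : K, T.dist x y ≤ F.dist x y) ∧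
      ∀ i x, F.dist (g i x) (g (i + 1) x) ≤ T.dist (g i x) (g (i + 1) x) := by
  classical
  let p : K → K := fun v => if hv : ∃ i, g (i + 1) v ≠ v then g (Nat.find hv + 1) v else v
  let rank : K → ℕ∞ := fun v => if hv : ∃ i, g (i + 1) v ≠ v then (Nat.find hv : ℕ∞) else ⊤
  obtain ⟨F, hF, hp⟩ := T.exists_spanning_of_parent (p := p) rank (fun v hv => by
    by_cases hex : ∃ i, g (i + 1) v ≠ v
    · simp only [p, dif_pos hex]
      simp only [rank, dif_pos hex]
      split_ifs with hex'
      · rw [Nat.cast_lt, Nat.lt_find_iff]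
        intro j hj
        rw [not_not]
        exact hg.apply_of_le (by omega) v
      · exact ENat.natCast_lt_top _
    · exact absurd (dif_neg hex) hv)
  refine ⟨F, hF, fun i x => ?_⟩
  by_cases hv : g (i + 1) (g i x) = g i x
  · rw [← hg.succ_apply, hv]
    simp
  · have hex : ∃ i', g (i' + 1) (g i x) ≠ g i x := ⟨i, hv⟩
    have hfind : Nat.find hex = i :=
      (Nat.find_eq_iff hex).2 ⟨hv, fun j hj => not_not.2 (hg.apply_of_le (by omega) x)⟩
    have hpv : p (g i x) = g (i + 1) x := by
      simp only [p, dif_pos hex, hfind, hg.succ_apply]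
    rw [← hpv]
    exact hp (g i x)

end WeightedTree

/-- The lower end of the band `[c + b * w, c + (b + 1) * w)`, `b` an integer, that contains `h`. -/
noncomputable def bandBase (c w h : ℝ) : ℝ :=
  c + ⌊(h - c) / w⌋ * w

theorem bandBase_le {w : ℝ} (hw : 0 < w) (c h : ℝ) : bandBase c w h ≤ h := by
  have := (le_div_iff₀ hw).1 (Int.floor_le ((h - c) / w))
  rw [bandBase]
  linarith

theorem lt_bandBase_add {w : ℝ} (hw : 0 < w) (c h : ℝ) : h < bandBase c w h + w := by
  have := (div_lt_iff₀ hw).1 (Int.lt_floor_add_one ((h - c) / w))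
  rw [bandBase]
  linarith

theorem bandBase_eq {w : ℝ} (hw : 0 < w) {c h : ℝ} {b : ℤ} (h1 : c + b * w ≤ h)
    (h2 : h < c + b * w + w) : bandBase c w h = c + b * w := by
  have : ⌊(h - c) / w⌋ = b := by
    rw [Int.floor_eq_iff, le_div_iff₀ hw, div_lt_iff₀ hw]
    constructor <;> linarith
  rw [bandBase, this]

namespace WeightedTree

variable {V : Type*} (T : WeightedTree V)

/-- Terminals are related if they lie in the same band and below the same point at its top. -/
noncomputable def bandSetoid (r : V) (K : Finset V) {w : ℝ} (hw : 0 < w) (c : ℝ) : Setoid K where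
  r x y := bandBase c w (T.dist r x) = bandBase c w (T.dist r y) ∧
    bandBase c w (T.dist r x) ≤ T.gromov r x y
  iseqv :=
    { refl := fun x => ⟨rfl, by rw [gromov_self]; exact bandBase_le hw c _⟩
      symm := fun {x y} h => ⟨h.1.symm, by rw [← h.1, T.gromov_comm]; exact h.2⟩
      trans := fun {x y z} h h' =>
        ⟨h.1.trans h'.1, T.le_gromov_trans h.2 (by rw [h.1]; exact h'.2)⟩ }

theorem bandSetoid_iff {r : V} {K : Finset V} {w : ℝ} {hw : 0 < w} {c : ℝ} {x y : K} :
    T.bandSetoid r K hw c x y ↔ bandBase c w (T.dist r x) = bandBase c w (T.dist r y) ∧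
      bandBase c w (T.dist r x) ≤ T.gromov r x y :=
  Iff.rfl

/-- One tree serves all pairs whose distance is within a factor `m - 3` of one of the resolutions
`δ₀ * ρ ^ i`, and for which the cuts at that resolution with offset `k` meet the right place. -/
theorem exists_spanning_of_resolutions (r : V) {K : Finset V} [Nonempty K] {δ₀ ρ : ℝ} {m : ℕ}
    (hδ₀ : 0 < δ₀) (hm : 0 < m) (hρ : 2 * m + 1 ≤ ρ) (k : ℝ) :
    ∃ F : WeightedTree K, (∀ x y : K, T.dist x y ≤ F.dist x y) ∧
      ∀ (x y : K) (i : ℕ) (b : ℤ),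
        (k + b * m) * (δ₀ * ρ ^ i) ≤ T.gromov r x y - δ₀ * ρ ^ i →
        T.gromov r x y - 2 * (δ₀ * ρ ^ i) < (k + b * m) * (δ₀ * ρ ^ i) →
        T.dist x y ≤ (m - 3) * (δ₀ * ρ ^ i) →
        F.dist x y ≤ 2 * T.dist x y + 14 * (δ₀ * ρ ^ i) := by
  have hm' : (0 : ℝ) < m := by exact_mod_cast hm
  have hρ0 : 0 < ρ := by linarith
  set δ : ℕ → ℝ := fun i => δ₀ * ρ ^ i with hδdef
  have hδ : ∀ i, 0 < δ i := fun i => by positivity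
  have hw : ∀ i, 0 < m * δ i := fun i => mul_pos hm' (hδ i)
  obtain ⟨g, hg⟩ := exists_isHubSequence (fun i => T.bandSetoid r K (hw i) (k * δ i))
    (fun x => T.dist r x)
  obtain ⟨F, hF, hstep⟩ := T.exists_spanning_of_isHubSequence hg
  have hrel := fun i x => T.bandSetoid_iff.1 (hg.rel i x)
  have hle := hg.height_le
  have hup : ∀ i x, T.dist (g i x) (g (i + 1) x) ≤ T.dist r (g i x) + T.dist r (g (i + 1) x) -
      2 * bandBase (k * δ i) (m * δ i) (T.dist r (g i x)) := by
    intro i x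
    rw [T.dist_eq_gromov r]
    linarith [(hrel i x).2]
  -- A step at level `i` costs at most twice the band width `m * δ i`; with the earlier drift this
  -- is at most `(2 * m + 1) * δ i`, hence at most `δ (i + 1)`.
  have hdrift : ∀ i x, F.dist x (g i x) ≤ δ i := by
    intro i x
    induction i with
    | zero => rw [hg.zero, dist_self]; exact (hδ 0).le
    | succ i ih =>
      have h1 := F.dist_triangle x (g i x) (g (i + 1) x)
      have h2 := hstep i x
      have h3 := hup i x
      have h4 := hle i x
      have h5 := lt_bandBase_add (hw i) (k * δ i) (T.dist r (g i x))
      have h6 : δ (i + 1) = ρ * δ i := by simp only [hδdef]; ring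
      have h7 := mul_le_mul_of_nonneg_right hρ (hδ i).le
      rw [h6]
      linarith
  refine ⟨F, hF, fun x y i b h1 h2 h3 => ?_⟩
  change (k + b * m) * δ i ≤ T.gromov r x y - δ i at h1
  change T.gromov r x y - 2 * δ i < (k + b * m) * δ i at h2
  change T.dist x y ≤ (m - 3) * δ i at h3
  change F.dist x y ≤ 2 * T.dist x y + 14 * δ i
  have hxx := (hF x (g i x)).trans (hdrift i x)
  have hyy := (hF y (g i y)).trans (hdrift i y)
  have hx1 := T.dist_triangle r x (g i x)
  have hx2 := T.dist_triangle r (g i x) x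
  have hy1 := T.dist_triangle r y (g i y)
  have hy2 := T.dist_triangle r (g i y) y
  rw [T.dist_comm (g i x) x] at hx2
  rw [T.dist_comm (g i y) y] at hy2
  have hax := T.gromov_le_left r x y
  have hay := T.gromov_le_right r x y
  have hd := T.dist_eq_gromov r x y
  -- The cut is at least `δ i` above the branching point, so a drift of `δ i` does not leave the
  -- subtree below the cut.
  have hgx : (k + b * m) * δ i ≤ T.gromov r (g i x) x := by
    rw [gromov, T.dist_comm (g i x) x]
    linarith
  have hgy : (k + b * m) * δ i ≤ T.gromov r y (g i y) := by
    rw [gromov]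
    linarith
  have hgxy : (k + b * m) * δ i ≤ T.gromov r (g i x) (g i y) :=
    T.le_gromov_trans hgx (T.le_gromov_trans (by linarith [hδ i]) hgy)
  have hq : (k + b * m) * δ i = k * δ i + b * (m * δ i) := by ring
  -- The 3 in `m - 3` pays for the drift and for the gap of up to `2 * δ i` between cut and
  -- branching point, so the drifted point stays in the band.
  have hbx : bandBase (k * δ i) (m * δ i) (T.dist r (g i x)) = (k + b * m) * δ i := by
    rw [hq]
    refine bandBase_eq (hw i) ?_ ?_ <;> rw [← hq] <;> linarith
  have hby : bandBase (k * δ i) (m * δ i) (T.dist r (g i y)) = (k + b * m) * δ i := by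
    rw [hq]
    refine bandBase_eq (hw i) ?_ ?_ <;> rw [← hq] <;> linarith
  have heq : g (i + 1) x = g (i + 1) y :=
    hg.eq_of_rel i x y (T.bandSetoid_iff.2 ⟨hbx.trans hby.symm, by rwa [hbx]⟩)
  have hux := hup i x
  have huy := hup i y
  have hlx := hle i x
  have hly := hle i y
  have hsx := hstep i x
  have hsy := hstep i y
  have hdx := hdrift i x
  have hdy := hdrift i y
  rw [hbx] at hux
  rw [hby] at huy
  rw [← heq] at huy hly hsy
  -- On each side the drift costs `δ i`, and the step to the hub at most twice the depth of the
  -- terminal below the branching point plus `6 * δ i`; together this gives the 14.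
  have t1 := F.dist_triangle x (g i x) y
  have t2 := F.dist_triangle (g i x) (g (i + 1) x) y
  have t3 := F.dist_triangle (g (i + 1) x) (g i y) y
  rw [F.dist_comm (g (i + 1) x) (g i y), F.dist_comm (g i y) y] at t3
  linarith

theorem exists_pos_le_dist (K : Finset V) :
    ∃ d : ℝ, 0 < d ∧ ∀ x ∈ K, ∀ y ∈ K, x ≠ y → d ≤ T.dist x y := by
  classical
  rcases K.offDiag.eq_empty_or_nonempty with h | h
  · refine ⟨1, one_pos, fun x hx y hy hxy => ?_⟩
    have : (x, y) ∈ K.offDiag := Finset.mem_offDiag.2 ⟨hx, hy, hxy⟩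
    simp [h] at this
  · obtain ⟨q, hq, hmin⟩ := K.offDiag.exists_min_image (fun q => T.dist q.1 q.2) h
    exact ⟨_, T.dist_pos (Finset.mem_offDiag.1 hq).2.2,
      fun x hx y hy hxy => hmin (x, y) (Finset.mem_offDiag.2 ⟨hx, hy, hxy⟩)⟩

end WeightedTree

theorem hasNonSteinerTreeCover_two_add {V : Type*} (T : WeightedTree V) {K : Finset V}
    (hK : K.Nonempty) {ε s : ℝ} {m : ℕ} (hε : 0 < ε) (hs : 1 < s) (hsm : 2 * m + 1 ≤ s ^ 2)
    (hm : 14 * s ≤ (m - 3) * ε) : HasNonSteinerTreeCover T K (2 + ε) (2 * m) := by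
  have hm3 : (3 : ℝ) < m := by
    by_contra! h
    nlinarith
  have hm0 : 0 < m := by
    have : (0 : ℝ) < m := by linarith
    exact_mod_cast this
  obtain ⟨r, -⟩ := id hK
  have : Nonempty K := hK.to_subtype
  obtain ⟨d₀, hd₀, hmin⟩ := T.exists_pos_le_dist K
  -- For a distance in `[s ^ l * d₀, s ^ (l + 1) * d₀)` the additive error at resolution `δ₀ * s ^
  -- l` is then at most `ε` times the distance.
  set δ₀ := ε * d₀ / 14 with hδdef
  have hδ₀ : 0 < δ₀ := by positivity
  have hpow : ∀ c i : ℕ, δ₀ * s ^ c * (s ^ 2) ^ i = δ₀ * s ^ (2 * i + c) := by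
    intro c i
    rw [← pow_mul, pow_add]
    ring
  have := HasNonSteinerTreeCover.of_forall (T := T) (K := K) (α := 2 + ε) (ι := Fin 2 × Fin m)
    (fun x y j => x = y ∨ ∃ (i : ℕ) (b : ℤ),
        ((j.2 : ℕ) + b * m) * (δ₀ * s ^ (j.1 : ℕ) * (s ^ 2) ^ i) ≤
          T.gromov r x y - δ₀ * s ^ (j.1 : ℕ) * (s ^ 2) ^ i ∧
        T.gromov r x y - 2 * (δ₀ * s ^ (j.1 : ℕ) * (s ^ 2) ^ i) <
          ((j.2 : ℕ) + b * m) * (δ₀ * s ^ (j.1 : ℕ) * (s ^ 2) ^ i) ∧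
        T.dist x y ≤ (m - 3) * (δ₀ * s ^ (j.1 : ℕ) * (s ^ 2) ^ i) ∧
        14 * (δ₀ * s ^ (j.1 : ℕ) * (s ^ 2) ^ i) ≤ ε * T.dist x y)
    (fun j => ?_) (fun x y => ?_)
  · simpa using this
  · obtain ⟨F, hF, h⟩ := T.exists_spanning_of_resolutions r (K := K)
      (δ₀ := δ₀ * s ^ (j.1 : ℕ)) (ρ := s ^ 2) (m := m) (by positivity) hm0 hsm (j.2 : ℕ)
    refine ⟨F, hF, ?_⟩
    rintro x y (rfl | ⟨i, b, h1, h2, h3, h4⟩)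
    · simp
    · have := h x y i b h1 h2 h3
      linarith
  · by_cases hxy : x = y
    · exact ⟨(0, ⟨0, hm0⟩), .inl hxy⟩
    have hd := hmin x x.2 y y.2 fun h => hxy (Subtype.ext h)
    obtain ⟨l, hl1, hl2⟩ := exists_nat_pow_near
      (x := T.dist x y / d₀) (by rwa [le_div_iff₀ hd₀, one_mul]) hs
    rw [le_div_iff₀ hd₀] at hl1
    rw [div_lt_iff₀ hd₀] at hl2
    set δ := δ₀ * s ^ l with hδ
    have hδpos : 0 < δ := by positivity
    -- The cut at depth `q * δ` is between `δ` and `2 * δ` above the branching point. The residues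
    -- of `q` modulo `m` and of `l` modulo 2 select the tree; the ratio of consecutive resolutions
    -- within a tree is `s ^ 2`.
    set q : ℤ := ⌊T.gromov r x y / δ⌋ - 1 with hq
    have hq1 : q * δ ≤ T.gromov r x y - δ := by
      have := (le_div_iff₀ hδpos).1 (Int.floor_le (T.gromov r x y / δ))
      rw [hq]
      push_cast
      linarith
    have hq2 : T.gromov r x y - 2 * δ < q * δ := by
      have := (div_lt_iff₀ hδpos).1 (Int.lt_floor_add_one (T.gromov r x y / δ))
      rw [hq]
      push_cast
      linarith
    have hmz : (m : ℤ) ≠ 0 := by exact_mod_cast hm0.ne'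
    have hk0 := Int.emod_nonneg q hmz
    have hkm := Int.emod_lt_of_pos q (show (0 : ℤ) < m by exact_mod_cast hm0)
    have hqk : (((q % m).toNat : ℕ) : ℝ) + ((q / m : ℤ) : ℝ) * m = q := by
      have h1 : (((q % m).toNat : ℕ) : ℤ) + (q / m) * m = q := by
        rw [Int.toNat_of_nonneg hk0, mul_comm]
        exact Int.emod_add_mul_ediv q m
      exact_mod_cast h1
    refine ⟨(⟨l % 2, Nat.mod_lt _ two_pos⟩, ⟨(q % m).toNat, by omega⟩),
      .inr ⟨l / 2, q / m, ?_⟩⟩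
    simp only [hpow, Nat.div_add_mod, hqk, ← hδ]
    refine ⟨hq1, hq2, ?_, ?_⟩
    · have h1 : s ^ (l + 1) * d₀ * ε = 14 * s * δ := by
        rw [hδ, hδdef]
        ring
      have h2 := mul_le_mul_of_nonneg_right hm hδpos.le
      have h3 := mul_lt_mul_of_pos_right hl2 hε
      refine le_of_mul_le_mul_right ?_ hε
      linarith
    · have h1 : 14 * δ = ε * (s ^ l * d₀) := by
        rw [hδ, hδdef]
        ring
      rw [h1]
      exact mul_le_mul_of_nonneg_left hl1 hε.le

theorem exists_hasNonSteinerTreeCover_two_add {V : Type*} (T : WeightedTree V) (K : Finset V)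
    {ε : ℝ} (hε : 0 < ε) (hε1 : ε < 1) :
    ∃ β : ℕ, (β : ℝ) ≤ 820 * ε⁻¹ ^ 2 ∧ HasNonSteinerTreeCover T K (2 + ε) β := by
  rcases K.eq_empty_or_nonempty with rfl | hK
  · exact ⟨0, by simpa using by positivity, .of_isEmpty⟩
  have h1 : 1 < ε⁻¹ := (one_lt_inv₀ hε).2 hε1
  have h2 : ε⁻¹ * ε = 1 := inv_mul_cancel₀ hε.ne'
  have hc := Nat.le_ceil (406 * ε⁻¹ ^ 2)
  have hc' := Nat.ceil_lt_add_one (show 0 ≤ 406 * ε⁻¹ ^ 2 by positivity)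
  -- Here 406 = 14 * 29 makes the additive error small enough, and 29 ^ 2 = 841 leaves room for `2 *
  -- m + 1`, about 812 times `ε⁻¹ ^ 2`.
  refine ⟨2 * (⌈406 * ε⁻¹ ^ 2⌉₊ + 3), ?_,
    hasNonSteinerTreeCover_two_add T hK (s := 29 * ε⁻¹) hε (by linarith) ?_ ?_⟩
  · push_cast
    nlinarith
  · push_cast
    nlinarith
  · push_cast
    have h3 := mul_le_mul_of_nonneg_right hc hε.le
    have h4 : 406 * ε⁻¹ ^ 2 * ε = 406 * ε⁻¹ := by
      rw [pow_two, mul_assoc, mul_assoc, h2, mul_one]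
    linarith

/-! ### Paths of few edges and the lower bound for stretch 2 - ε. -/

namespace WeightedTree

variable {V : Type*} (T : WeightedTree V)

/-- If all edges have length at least `D`, a distance below `3 * D` is realized by at most two
edges. -/
theorem adj_or_exists_of_dist_lt {D : ℝ} (hD : ∀ u v, T.graph.Adj u v → D ≤ T.dist u v) {x y : V}
    (hxy : x ≠ y) (h : T.dist x y < 3 * D) : T.graph.Adj x y ∨
      ∃ k, T.graph.Adj x k ∧ T.graph.Adj k y ∧ T.dist x k + T.dist k y = T.dist x y := by
  obtain ⟨p, hp⟩ := T.exists_isPath x y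
  have hd := T.dist_eq_walkWeight hp
  match p, hd with
  | .nil, _ => exact absurd rfl hxy
  | .cons h1 .nil, _ => exact .inl h1
  | .cons h1 (.cons h2 .nil), hd =>
    refine .inr ⟨_, h1, h2, ?_⟩
    rw [hd, T.dist_eq_weight h1, T.dist_eq_weight h2]
    simp
  | .cons h1 (.cons h2 (.cons h3 p)), hd =>
    simp only [walkWeight_cons, ← T.dist_eq_weight h1, ← T.dist_eq_weight h2,
      ← T.dist_eq_weight h3] at hd
    linarith [hD _ _ h1, hD _ _ h2, hD _ _ h3, T.walkWeight_nonneg p]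

/-- The star graph with unit weights. -/
def unitStar (r : V) : WeightedTree V where
  graph := SimpleGraph.starGraph r
  isTree := SimpleGraph.isTree_starGraph r
  weight _ := 1
  weight_pos _ _ := one_pos

theorem unitStar_dist {r x y : V} (hx : x ≠ r) (hy : y ≠ r) (hxy : x ≠ y) :
    (unitStar r).dist x y = 2 := by
  classical
  apply le_antisymm
  · have h1 : (unitStar r).dist x r = 1 :=
      (unitStar r).dist_eq_weight (SimpleGraph.starGraph_center_adj' hx.symm)
    have h2 : (unitStar r).dist r y = 1 :=
      (unitStar r).dist_eq_weight (SimpleGraph.starGraph_center_adj hy.symm)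
    have := (unitStar r).dist_triangle x r y
    linarith
  · have := (unitStar r).sub_le_dist
      (φ := fun u => if u = x then -1 else if u = y then 1 else 0) (fun u v huv => by
        change _ ≤ (1 : ℝ)
        have huv' : u ≠ v ∧ (u = r ∨ v = r) := SimpleGraph.starGraph_adj.1 huv
        rcases huv'.2 with rfl | rfl
        · rw [if_neg hx.symm, if_neg hy.symm]
          split_ifs <;> norm_num
        · rw [if_neg hx.symm, if_neg hy.symm]
          split_ifs <;> norm_num) x y
    simp only [if_neg hxy.symm, if_true] at this
    linarith

end WeightedTree

/-- With N vertices, N(N - 1)/2 pairs must be covered by trees of N - 1 edges each. -/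
theorem card_le_of_adj_cover {K : Type*} [Fintype K] {β : ℕ} {G : Fin β → SimpleGraph K}
    (hG : ∀ i, (G i).IsTree) (h : ∀ x y, x ≠ y → ∃ i, (G i).Adj x y) (hK : 2 ≤ Fintype.card K) :
    Fintype.card K ≤ 2 * β := by
  classical
  have h1 : (⊤ : SimpleGraph K).edgeFinset ⊆ Finset.univ.biUnion fun i => (G i).edgeFinset := by
    intro e
    induction e using Sym2.ind with
    | _ x y =>
      intro he
      rw [SimpleGraph.mem_edgeFinset] at he
      obtain ⟨i, hi⟩ := h x y he
      exact Finset.mem_biUnion.2 ⟨i, Finset.mem_univ i, SimpleGraph.mem_edgeFinset.2 hi⟩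
  have h2 := (Finset.card_le_card h1).trans (Finset.card_biUnion_le_card_mul _ _
    (Fintype.card K - 1) fun i _ => by have := (hG i).card_edgeFinset; omega)
  rw [SimpleGraph.card_edgeFinset_top_eq_card_choose_two, Nat.choose_two_right, Finset.card_univ,
    Fintype.card_fin] at h2
  have h3 := Nat.even_mul_pred_self (Fintype.card K)
  have h4 := Nat.div_two_mul_two_of_even h3
  have h5 : Fintype.card K * (Fintype.card K - 1) ≤ 2 * β * (Fintype.card K - 1) := by
    rw [← h4]
    nlinarith
  exact Nat.le_of_mul_le_mul_right h5 (by omega)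

theorem IsNonSteinerTreeCover.pos {V : Type*} {T : WeightedTree V} {K : Finset V} {α : ℝ} {β : ℕ}
    {F : Fin β → WeightedTree K} (h : IsNonSteinerTreeCover T K α F) (hK : K.Nonempty) : 0 < β := by
  obtain ⟨x, hx⟩ := hK
  exact (h.low_stretch ⟨x, hx⟩ ⟨x, hx⟩).choose.pos

theorem unitStar_cover_size {V : Type*} [Fintype V] [DecidableEq V] (r : V) {α : ℝ} (hα : α < 2)
    {β : ℕ} (h : HasNonSteinerTreeCover (WeightedTree.unitStar r) (Finset.univ.erase r) α β) :
    (Finset.univ.erase r).card ≤ 2 * β := by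
  obtain ⟨F, hF⟩ := h
  rcases Nat.lt_or_ge (Finset.univ.erase r).card 2 with hK | hK
  · rcases (Finset.univ.erase r).eq_empty_or_nonempty with hK0 | hK0
    · simp [hK0]
    · have := hF.pos hK0
      omega
  have hdist : ∀ x y : (Finset.univ.erase r : Finset V), x ≠ y →
      (WeightedTree.unitStar r).dist x y = 2 := fun x y hxy =>
    WeightedTree.unitStar_dist (Finset.ne_of_mem_erase x.2) (Finset.ne_of_mem_erase y.2)
      fun h => hxy (Subtype.ext h)
  have := card_le_of_adj_cover (G := fun i => (F i).graph) (fun i => (F i).isTree)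
    (fun x y hxy => ?_) (by rwa [Fintype.card_coe])
  · rwa [Fintype.card_coe] at this
  · obtain ⟨i, hi⟩ := hF.low_stretch x y
    rw [hdist x y hxy] at hi
    -- Two edges already have total length at least 4, too long for stretch below 2 at distance 2.
    have hD : ∀ u v, u ≠ v → 2 ≤ (F i).dist u v := fun u v huv =>
      (hdist u v huv).symm.le.trans (hF.dominating i u v)
    refine ⟨i, ((F i).adj_or_exists_of_dist_lt (fun u v huv => hD u v huv.ne) hxy
      (by linarith)).resolve_right ?_⟩
    rintro ⟨k, h1, h2, h3⟩
    linarith [hD _ _ h1.ne, hD _ _ h2.ne]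

/-! ### The lower bound for the comb. -/

theorem SimpleGraph.IsTree.exists_parent {V : Type*} {G : SimpleGraph V} (hG : G.IsTree) :
    ∃ p : V → V, ∀ u v, G.Adj u v → p u = v ∨ p v = u := by
  obtain ⟨r⟩ := hG.connected.nonempty
  choose w hw huniq using fun u => hG.existsUnique_path u r
  refine ⟨fun u => (w u).snd, fun u v huv => ?_⟩
  by_cases h : v ∈ (w u).support
  · exact .inl (hG.isAcyclic.eq_snd_of_adj_start (hw u) huv h).symm
  · right
    beta_reduce
    rw [← huniq v (.cons huv.symm (w u)) ((hw u).cons h)]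
    simp

/-- The distance of two vertices of the path on `n` vertices. -/
def finGap {n : ℕ} (i j : Fin n) : ℕ :=
  ((i : ℤ) - j).natAbs

theorem finGap_comm {n : ℕ} (i j : Fin n) : finGap i j = finGap j i := by
  unfold finGap
  omega

theorem finGap_pos {n : ℕ} {i j : Fin n} (h : i ≠ j) : 0 < finGap i j := by
  rw [Ne, Fin.ext_iff] at h
  unfold finGap
  omega

theorem finGap_triangle {n : ℕ} (i j k : Fin n) : finGap i k ≤ finGap i j + finGap j k := by
  unfold finGap
  omega

theorem finGap_lt {n : ℕ} (i j : Fin n) : finGap i j < n := by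
  unfold finGap
  omega

theorem log_add_one_le_sum_range (m : ℕ) :
    Real.log (m + 1) ≤ ∑ k ∈ Finset.range m, (1 : ℝ) / (k + 1) := by
  have := log_add_one_le_harmonic m
  rw [harmonic] at this
  push_cast at this
  simpa [one_div] using this

/-- The two sides of `i` give harmonic sums, at least log (i + 1) and log (n - i), and (i + 1)(n -
i) ≥ n. The term `j = i` is `1 / 0 = 0`. -/
theorem log_le_sum_inv_finGap {n : ℕ} (i : Fin n) :
    Real.log n ≤ ∑ j, (1 : ℝ) / finGap i j := by
  obtain ⟨i, hi⟩ := i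
  obtain ⟨m, rfl⟩ := Nat.exists_eq_add_of_le hi
  have h0 : ∑ j : Fin (i + 1 + m), (1 : ℝ) / finGap ⟨i, hi⟩ j =
      ∑ j ∈ Finset.range (i + 1 + m), (1 : ℝ) / ((i : ℤ) - (j : ℤ)).natAbs :=
    Fin.sum_univ_eq_sum_range (fun j : ℕ => (1 : ℝ) / ((i : ℤ) - (j : ℤ)).natAbs) (i + 1 + m)
  rw [h0, Finset.sum_range_add, ← Finset.sum_range_reflect, Finset.sum_range_succ']
  have h1 : ∀ k ∈ Finset.range i,
      (1 : ℝ) / ((i : ℤ) - ((i + 1 - 1 - (k + 1) : ℕ) : ℤ)).natAbs = 1 / (k + 1) := by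
    intro k hk
    rw [Finset.mem_range] at hk
    have : ((i : ℤ) - ((i + 1 - 1 - (k + 1) : ℕ) : ℤ)).natAbs = k + 1 := by omega
    rw [this]
    push_cast
    rfl
  have h2 : ∀ k ∈ Finset.range m,
      (1 : ℝ) / ((i : ℤ) - ((i + 1 + k : ℕ) : ℤ)).natAbs = 1 / (k + 1) := by
    intro k _
    have : ((i : ℤ) - ((i + 1 + k : ℕ) : ℤ)).natAbs = k + 1 := by omega
    rw [this]
    push_cast
    rfl
  rw [Finset.sum_congr rfl h1, Finset.sum_congr rfl h2]
  have h3 := log_add_one_le_sum_range i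
  have h4 := log_add_one_le_sum_range m
  have h5 : Real.log ((i + 1 + m : ℕ) : ℝ) ≤ Real.log (i + 1) + Real.log (m + 1) := by
    rw [← Real.log_mul (by positivity) (by positivity)]
    apply Real.log_le_log
    · positivity
    · have : (0 : ℝ) ≤ i * m := by positivity
      push_cast
      nlinarith
  have h6 : (0 : ℝ) ≤ 1 / ((i : ℤ) - ((i + 1 - 1 - 0 : ℕ) : ℤ)).natAbs := by positivity
  linarith

theorem card_finGap_le {n : ℕ} (i : Fin n) (l : ℕ) :
    (Finset.univ.filter fun j => j ≠ i ∧ finGap i j ≤ l).card ≤ 2 * l := by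
  classical
  have h : (Finset.univ.filter fun j => j ≠ i ∧ finGap i j ≤ l).card ≤
      ((Finset.Icc ((i : ℤ) - l) (i + l)).erase i).card := by
    apply Finset.card_le_card_of_injOn fun j : Fin n => ((j : ℕ) : ℤ)
    · intro j hj
      have hj' := (Finset.mem_filter.1 hj).2
      rw [Ne, Fin.ext_iff, finGap] at hj'
      simp only [Finset.coe_erase, Finset.coe_Icc, Set.mem_sdiff, Set.mem_Icc,
        Set.mem_singleton_iff]
      omega
    · intro j _ j' _ hjj'
      exact Fin.ext (by simpa using hjj')
  rw [Finset.card_erase_of_mem (by simp), Int.card_Icc] at h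
  omega

/-- An upper estimate for `1 / finGap i j` when `j` is the image of `i` under `p`, or not farther
from `i` than twice that image; its sum over `j` is bounded. -/
noncomputable def nearWeight {n : ℕ} (p : Fin n → Fin n) (i j : Fin n) : ℝ :=
  if j ≠ i ∧ finGap i j ≤ 2 * finGap i (p i) then 2 / finGap i (p i) else 0

theorem nearWeight_nonneg {n : ℕ} (p : Fin n → Fin n) (i j : Fin n) : 0 ≤ nearWeight p i j := by
  unfold nearWeight
  split_ifs <;> positivity

/-- At most `4 * finGap i (p i)` values of `j` contribute, each `2 / finGap i (p i)`. -/
theorem sum_nearWeight_le {n : ℕ} (p : Fin n → Fin n) (i : Fin n) :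
    ∑ j, nearWeight p i j ≤ 8 := by
  unfold nearWeight
  rw [← Finset.sum_filter, Finset.sum_const, nsmul_eq_mul]
  have h : ((Finset.univ.filter fun j => j ≠ i ∧ finGap i j ≤ 2 * finGap i (p i)).card : ℝ) ≤
      4 * finGap i (p i) := by
    have := card_finGap_le i (2 * finGap i (p i))
    exact_mod_cast this.trans_eq (by ring)
  rcases Nat.eq_zero_or_pos (finGap i (p i)) with h0 | h0
  · simp [h0]
  · have h0' : (0 : ℝ) < finGap i (p i) := by exact_mod_cast h0
    rw [mul_div_assoc', div_le_iff₀ h0']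
    linarith

theorem inv_finGap_le_nearWeight {n : ℕ} {p : Fin n → Fin n} {i j : Fin n} (hij : i ≠ j)
    (h1 : finGap i j ≤ 2 * finGap i (p i)) (h2 : finGap i (p i) ≤ 2 * finGap i j) :
    (1 : ℝ) / finGap i j ≤ nearWeight p i j := by
  have h0 := finGap_pos hij
  rw [nearWeight, if_pos ⟨hij.symm, h1⟩, div_le_div_iff₀ (by exact_mod_cast h0)
    (by exact_mod_cast (by omega : 0 < finGap i (p i)))]
  exact_mod_cast (by omega : 1 * finGap i (p i) ≤ 2 * finGap i j)

/-- The pairs that a tree with parent function `p` can serve by a path of at most two edges whose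
total length is at most twice the distance. -/
def ParentServes {n : ℕ} (p : Fin n → Fin n) (i j : Fin n) : Prop :=
  p i = j ∨ p j = i ∨ p (p i) = j ∨ p (p j) = i ∨
    p i = p j ∧ finGap i (p i) + finGap j (p j) ≤ 2 * finGap i j

theorem inv_finGap_le_of_parentServes {n : ℕ} {p : Fin n → Fin n} {i j : Fin n} (hij : i ≠ j)
    (h : ParentServes p i j) : (1 : ℝ) / finGap i j ≤ nearWeight p i j + nearWeight p j i +
      ((if p (p i) = j then 1 else 0) + if p (p j) = i then 1 else 0) := by
  have hi := nearWeight_nonneg p i j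
  have hj := nearWeight_nonneg p j i
  have h0 := finGap_pos hij
  have hone : (1 : ℝ) / finGap i j ≤ 1 := by
    rw [div_le_one (by exact_mod_cast h0)]
    exact_mod_cast h0
  have hI : ∀ P : Prop, [Decidable P] → (0 : ℝ) ≤ if P then 1 else 0 := fun P _ => by
    split_ifs <;> norm_num
  have hI1 := hI (p (p i) = j)
  have hI2 := hI (p (p j) = i)
  rcases h with h | h | h | h | ⟨h, h'⟩
  · have := inv_finGap_le_nearWeight (p := p) hij (by rw [h]; omega) (by rw [h]; omega)
    linarith
  · have := inv_finGap_le_nearWeight (p := p) hij.symm (by rw [h]; omega) (by rw [h]; omega)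
    rw [finGap_comm] at this
    linarith
  · rw [if_pos h]
    linarith
  · rw [if_pos h]
    linarith
  -- For siblings, the longer of the two gaps to the common parent is within a factor 2 of `finGap i
  -- j`, so the pair is charged to that end.
  · have htri := finGap_triangle i (p i) j
    rw [finGap_comm (p i) j] at htri
    have hpj : finGap j (p i) = finGap j (p j) := by rw [h]
    rcases le_total (finGap j (p j)) (finGap i (p i)) with hle | hle
    · have := inv_finGap_le_nearWeight (p := p) hij (by omega) (by omega)
      linarith
    · have := inv_finGap_le_nearWeight (p := p) hij.symm (by rw [finGap_comm]; omega)
        (by rw [finGap_comm j i]; omega)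
      rw [finGap_comm] at this
      linarith

/-- Double counting over ordered pairs: a tree contributes at most 8n for each of the two
`nearWeight` terms and n for each of the two grandparent terms, 18n in all. -/
theorem log_le_of_parentServes {n β : ℕ} (hn : 0 < n) {p : Fin β → Fin n → Fin n}
    (h : ∀ i j, i ≠ j → ∃ t, ParentServes (p t) i j) : Real.log n ≤ 18 * β := by
  set W : Fin β → Fin n → Fin n → ℝ := fun t i j => nearWeight (p t) i j + nearWeight (p t) j i +
      ((if p t (p t i) = j then 1 else 0) + if p t (p t j) = i then 1 else 0) with hW
  have hW0 : ∀ t i j, 0 ≤ W t i j := by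
    intro t i j
    have h1 := nearWeight_nonneg (p t) i j
    have h2 := nearWeight_nonneg (p t) j i
    simp only [hW]
    split_ifs <;> linarith
  have hpair : ∀ i j, (1 : ℝ) / finGap i j ≤ ∑ t, W t i j := by
    intro i j
    by_cases hij : i = j
    · subst hij
      have : 0 ≤ ∑ t, W t i i := Finset.sum_nonneg fun t _ => hW0 t i i
      simpa [finGap] using this
    · obtain ⟨t, ht⟩ := h i j hij
      exact (inv_finGap_le_of_parentServes hij ht).trans
        (Finset.single_le_sum (f := fun t => W t i j) (fun t _ => hW0 t i j) (Finset.mem_univ t))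
  have htree : ∀ t, ∑ i, ∑ j, W t i j ≤ 18 * n := by
    intro t
    have h1 : ∑ i, ∑ j, nearWeight (p t) i j ≤ 8 * n := by
      have := Finset.sum_le_card_nsmul Finset.univ _ 8 fun i _ => sum_nearWeight_le (p t) i
      rw [Finset.card_univ, Fintype.card_fin, nsmul_eq_mul] at this
      linarith
    have h2 : ∑ i : Fin n, ∑ j, (if p t (p t i) = j then (1 : ℝ) else 0) = n := by simp
    simp only [hW, Finset.sum_add_distrib]
    rw [Finset.sum_comm (f := fun i j => nearWeight (p t) j i),
      Finset.sum_comm (f := fun i j => if p t (p t j) = i then (1 : ℝ) else 0)]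
    linarith
  have h1 : (n : ℝ) * Real.log n ≤ ∑ i : Fin n, ∑ j, (1 : ℝ) / finGap i j := by
    have := Finset.card_nsmul_le_sum Finset.univ _ _ fun i (_ : i ∈ (Finset.univ : Finset (Fin n))) =>
      log_le_sum_inv_finGap i
    rwa [Finset.card_univ, Fintype.card_fin, nsmul_eq_mul] at this
  have h2 : ∑ i : Fin n, ∑ j, (1 : ℝ) / finGap i j ≤ ∑ t, ∑ i, ∑ j, W t i j := by
    rw [Finset.sum_comm (s := (Finset.univ : Finset (Fin β)))]
    refine Finset.sum_le_sum fun i _ => ?_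
    rw [Finset.sum_comm (s := (Finset.univ : Finset (Fin β)))]
    exact Finset.sum_le_sum fun j _ => hpair i j
  have h3 : ∑ t, ∑ i, ∑ j, W t i j ≤ β * (18 * n) := by
    have := Finset.sum_le_card_nsmul Finset.univ _ _ fun t (_ : t ∈ (Finset.univ : Finset (Fin β))) =>
      htree t
    rwa [Finset.card_univ, Fintype.card_fin, nsmul_eq_mul] at this
  have hn' : (0 : ℝ) < n := by exact_mod_cast hn
  refine le_of_mul_le_mul_left ?_ hn'
  linarith

theorem combGraph_isTree {n : ℕ} (hn : 0 < n) : (combGraph n).IsTree := by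
  let p : Fin n ⊕ Fin n → Fin n ⊕ Fin n :=
    Sum.elim (fun i => Sum.inl ⟨i - 1, by omega⟩) Sum.inl
  have hle : combGraph n ≤ parentGraph p := by
    rintro (i | i) (j | j) h
    · have h' := SimpleGraph.pathGraph_adj.1 h
      rw [parentGraph_adj]
      simp only [p, Sum.elim_inl, Sum.inl.injEq, Fin.ext_iff, Ne]
      omega
    · obtain rfl : i = j := h
      exact parentGraph_adj.2 ⟨by simp, .inr rfl⟩
    · obtain rfl : i = j := h
      exact parentGraph_adj.2 ⟨by simp, .inl rfl⟩
    · exact h.elim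
  refine ⟨?_, (isAcyclic_parentGraph (p := p) (Sum.elim (fun i => -(i : ℤ)) fun _ => -(n : ℤ))
    ?_).anti hle⟩
  · have hpath : ∀ (k : ℕ) (hk : k < n),
        (combGraph n).Reachable (Sum.inl ⟨0, hn⟩) (Sum.inl ⟨k, hk⟩) := by
      intro k
      induction k with
      | zero => exact fun _ => SimpleGraph.Reachable.refl _
      | succ k ih =>
        intro hk
        refine (ih (by omega)).trans (SimpleGraph.Adj.reachable ?_)
        exact SimpleGraph.pathGraph_adj.2 (.inl rfl)
    refine (SimpleGraph.connected_iff_exists_forall_reachable _).2 ⟨Sum.inl ⟨0, hn⟩, ?_⟩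
    rintro (i | i)
    · exact hpath i i.2
    · refine (hpath i i.2).trans (SimpleGraph.Adj.reachable ?_)
      exact (rfl : i = i)
  · rintro (i | i) hi
    · simp only [p, Sum.elim_inl, Ne, Sum.inl.injEq, Fin.ext_iff] at hi ⊢
      omega
    · simp only [p, Sum.elim_inl, Sum.elim_inr]
      omega

theorem exists_isWeightedComb {n : ℕ} (hn : 0 < n) {M : ℝ} (hM : 0 < M) :
    ∃ T : WeightedTree (Fin n ⊕ Fin n), IsWeightedComb M T := by
  refine ⟨⟨combGraph n, combGraph_isTree hn,
    Sym2.lift ⟨fun a b => if a.isRight ∨ b.isRight then M else 1, fun a b => by simp [or_comm]⟩,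
    fun e _ => ?_⟩, rfl, fun i j _ => by simp, fun i => by simp⟩
  induction e using Sym2.ind with
  | _ a b =>
    rw [Sym2.lift_mk]
    dsimp only
    split_ifs
    exacts [hM, one_pos]

namespace IsWeightedComb

variable {n : ℕ} {M : ℝ} {T : WeightedTree (Fin n ⊕ Fin n)}

theorem dist_inl_le (hT : IsWeightedComb M T) (d : ℕ) :
    ∀ i j : Fin n, (i : ℕ) + d = j → T.dist (Sum.inl i) (Sum.inl j) ≤ d := by
  induction d with
  | zero =>
    intro i j hij
    obtain rfl : i = j := Fin.ext (by omega)
    simp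
  | succ d ih =>
    intro i j hij
    have h1 := ih i ⟨i + d, by omega⟩ rfl
    have hadj : (SimpleGraph.pathGraph n).Adj ⟨i + d, by omega⟩ j :=
      SimpleGraph.pathGraph_adj.2 (.inl (by simp only; omega))
    have h2 := T.dist_eq_weight (x := Sum.inl ⟨i + d, by omega⟩) (y := Sum.inl j)
      (by rw [hT.graph_eq]; exact hadj)
    rw [hT.weight_path _ _ hadj] at h2
    have h3 := T.dist_triangle (Sum.inl i) (Sum.inl ⟨i + d, by omega⟩) (Sum.inl j)
    push_cast
    linarith

theorem dist_tooth (hT : IsWeightedComb M T) (i : Fin n) :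
    T.dist (Sum.inl i) (Sum.inr i) = M := by
  rw [T.dist_eq_weight (by rw [hT.graph_eq]; exact (rfl : i = i)), hT.weight_tooth]

theorem dist_inr (hT : IsWeightedComb M T) (hM : 0 ≤ M) {i j : Fin n} (hij : i ≠ j) :
    T.dist (Sum.inr i) (Sum.inr j) = 2 * M + finGap i j := by
  wlog h : i < j generalizing i j
  · rw [T.dist_comm, finGap_comm]
    exact this hij.symm (lt_of_le_of_ne (not_lt.1 h) hij.symm)
  obtain ⟨d, hd⟩ := Nat.exists_eq_add_of_le (Fin.le_def.1 h.le)
  have hgap : finGap i j = d := by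
    unfold finGap
    omega
  rw [hgap]
  apply le_antisymm
  · have h1 := hT.dist_inl_le d i j hd.symm
    have h2 := hT.dist_tooth i
    have h3 := hT.dist_tooth j
    have h4 := T.dist_triangle (Sum.inr i) (Sum.inl i) (Sum.inr j)
    have h5 := T.dist_triangle (Sum.inl i) (Sum.inl j) (Sum.inr j)
    rw [T.dist_comm (Sum.inr i) (Sum.inl i)] at h4
    linarith
  -- This potential advances by 1 along the path and jumps by `M` at each tooth, downwards at teeth
  -- up to `i` and upwards after it.
  · have := T.sub_le_dist (φ := Sum.elim (fun k => ((k : ℕ) : ℝ))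
      fun k => if k ≤ i then ((k : ℕ) : ℝ) - M else ((k : ℕ) : ℝ) + M) (fun u v huv => by
        rw [hT.graph_eq] at huv
        rcases u with u | u <;> rcases v with v | v
        · rw [hT.weight_path u v huv]
          simp only [Sum.elim_inl]
          rcases SimpleGraph.pathGraph_adj.1 huv with h | h <;>
            have h' : ((_ : ℕ) : ℝ) = _ := congrArg Nat.cast h <;> push_cast at h' <;> linarith
        · obtain rfl : u = v := huv
          rw [hT.weight_tooth]
          simp only [Sum.elim_inl, Sum.elim_inr]
          split_ifs <;> linarith
        · obtain rfl : u = v := huv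
          rw [Sym2.eq_swap, hT.weight_tooth]
          simp only [Sum.elim_inl, Sum.elim_inr]
          split_ifs <;> linarith
        · exact huv.elim) (Sum.inr i) (Sum.inr j)
    simp only [Sum.elim_inr, le_refl, if_true, if_neg (not_le.2 h)] at this
    rw [hd] at this
    push_cast at this
    linarith

end IsWeightedComb

/-- The `i`-th tooth as a terminal. -/
def combTooth {n : ℕ} (i : Fin n) : combTeeth n :=
  ⟨Sum.inr i, by simp [combTeeth]⟩

theorem combTooth_surjective {n : ℕ} : Function.Surjective (combTooth (n := n)) := by
  rintro ⟨x, hx⟩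
  obtain ⟨i, -, rfl⟩ := Finset.mem_map.1 hx
  exact ⟨i, rfl⟩

theorem combTooth_injective {n : ℕ} : Function.Injective (combTooth (n := n)) :=
  fun _ _ h => Sum.inr_injective (congrArg Subtype.val h)

theorem IsWeightedComb.log_le {n : ℕ} (hn : 0 < n) {M : ℝ} (hM : (n : ℝ) ≤ M)
    {T : WeightedTree (Fin n ⊕ Fin n)} (hT : IsWeightedComb M T) {β : ℕ}
    (h : HasNonSteinerTreeCover T (combTeeth n) 2 β) : Real.log n ≤ 18 * β := by
  obtain ⟨F, hF⟩ := h
  have hn' : (0 : ℝ) < n := by exact_mod_cast hn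
  have hdist : ∀ i j : Fin n, i ≠ j →
      T.dist (combTooth i : Fin n ⊕ Fin n) (combTooth j) = 2 * M + finGap i j :=
    fun i j hij => hT.dist_inr (by linarith) hij
  have hparent : ∀ t, ∃ p : Fin n → Fin n,
      ∀ i j, (F t).graph.Adj (combTooth i) (combTooth j) → p i = j ∨ p j = i := by
    intro t
    obtain ⟨P, hP⟩ := (F t).isTree.exists_parent
    choose e he using combTooth_surjective (n := n)
    refine ⟨fun i => e (P (combTooth i)), fun i j hij => ?_⟩
    rcases hP _ _ hij with h | h
    · exact .inl (combTooth_injective (by rw [he, h]))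
    · exact .inr (combTooth_injective (by rw [he, h]))
  choose p hp using hparent
  refine log_le_of_parentServes hn (p := p) fun i j hij => ?_
  obtain ⟨t, ht⟩ := hF.low_stretch (combTooth i) (combTooth j)
  refine ⟨t, ?_⟩
  have hdom : ∀ i j : Fin n, i ≠ j →
      2 * M + finGap i j ≤ (F t).dist (combTooth i) (combTooth j) :=
    fun i j hij => (hdist i j hij).symm.le.trans (hF.dominating t _ _)
  rw [hdist i j hij] at ht
  have hlt : (finGap i j : ℝ) < n := by exact_mod_cast finGap_lt i j
  -- Edges have length at least `2 * M`, and `2 * (2 * M + finGap i j) < 6 * M` because `finGap i j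
  -- < n ≤ M`.
  rcases (F t).adj_or_exists_of_dist_lt (D := 2 * M) (fun u v huv => by
      obtain ⟨a, rfl⟩ := combTooth_surjective u
      obtain ⟨b, rfl⟩ := combTooth_surjective v
      have h1 := hdom a b fun hab => huv.ne (congrArg _ hab)
      have h2 : (0 : ℝ) ≤ finGap a b := Nat.cast_nonneg _
      linarith) (fun h => hij (combTooth_injective h)) (by linarith) with h | ⟨k, h1, h2, h3⟩
  · rcases hp t i j h with h | h
    · exact .inl h
    · exact .inr (.inl h)
  · obtain ⟨k, rfl⟩ := combTooth_surjective k
    have hik := hdom i k fun h => h1.ne (congrArg _ h)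
    have hkj := hdom k j fun h => h2.ne (congrArg _ h)
    have hsum : finGap i k + finGap k j ≤ 2 * finGap i j := by
      have : (finGap i k + finGap k j : ℝ) ≤ 2 * finGap i j := by linarith
      exact_mod_cast this
    rcases hp t i k h1 with ha | ha <;> rcases hp t k j h2 with hb | hb
    · exact .inr (.inr (.inl (by rw [ha, hb])))
    · refine .inr (.inr (.inr (.inr ⟨ha.trans hb.symm, ?_⟩)))
      rwa [ha, hb, finGap_comm j k]
    · exact absurd (ha.symm.trans hb) hij
    · exact .inr (.inr (.inr (.inl (by rw [hb, ha]))))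

/-! ### Assembly of the bounds. -/

theorem mainTheorem1 :
    -- stretch `2 + ε`: `O(ε⁻² log ε⁻¹)` trees suffice
    (∃ C : ℝ, 0 < C ∧ ∀ ε : ℝ, 0 < ε → ε < 1 →
      ∀ (V : Type*) [Finite V] (T : WeightedTree V) (K : Finset V),
        ∃ β : ℕ, (β : ℝ) ≤ C * (ε⁻¹ ^ 2 * (1 + Real.log ε⁻¹)) ∧
          HasNonSteinerTreeCover T K (2 + ε) β) ∧
    -- stretch `2`: `O(log n)` trees suffice
    (∃ C : ℝ, 0 < C ∧
      ∀ (V : Type*) [Finite V] (T : WeightedTree V) (K : Finset V), 2 ≤ K.card →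
        ∃ β : ℕ, (β : ℝ) ≤ C * Real.log K.card ∧ HasNonSteinerTreeCover T K 2 β) ∧
    -- stretch `2`: `Ω(log n)` trees are necessary, already for the comb graph
    (∃ c : ℝ, 0 < c ∧ ∀ (n : ℕ) (M : ℝ), 1 ≤ n → (n : ℝ) ≤ M →
      ∃ T : WeightedTree (Fin n ⊕ Fin n), IsWeightedComb M T ∧
        ∀ β : ℕ, HasNonSteinerTreeCover T (combTeeth n) 2 β → c * Real.log n ≤ β) ∧
    -- stretch `2 - ε`: `O(n)` trees suffice
    (∃ C : ℝ, 0 < C ∧ ∀ ε : ℝ, 0 < ε → ε < 1 →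
      ∀ (V : Type*) [Finite V] (T : WeightedTree V) (K : Finset V),
        ∃ β : ℕ, (β : ℝ) ≤ C * K.card ∧ HasNonSteinerTreeCover T K (2 - ε) β) ∧
    -- stretch `2 - ε`: `Ω(n)` trees are necessary
    (∃ c : ℝ, 0 < c ∧ ∀ ε : ℝ, 0 < ε → ε < 1 → ∀ n : ℕ, 1 ≤ n →
      ∃ (T : WeightedTree (Fin (n + 1))) (K : Finset (Fin (n + 1))), K.card = n ∧
        ∀ β : ℕ, HasNonSteinerTreeCover T K (2 - ε) β → c * n ≤ β) := by
  refine ⟨⟨820, by norm_num, fun ε hε hε1 V _ T K => ?_⟩,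
    ⟨5, by norm_num, fun V _ T K hK => ?_⟩,
    ⟨1 / 18, by norm_num, fun n M hn hM => ?_⟩,
    ⟨1, one_pos, fun ε hε hε1 V _ T K =>
      ⟨K.card, by simp, hasNonSteinerTreeCover_card T K (by linarith)⟩⟩,
    ⟨1 / 2, by norm_num, fun ε hε hε1 n hn =>
      ⟨WeightedTree.unitStar 0, Finset.univ.erase 0, by simp, fun β hβ => ?_⟩⟩⟩
  · obtain ⟨β, hβ, h⟩ := exists_hasNonSteinerTreeCover_two_add T K hε hε1
    refine ⟨β, hβ.trans ?_, h⟩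
    have h1 : 0 ≤ Real.log ε⁻¹ := Real.log_nonneg ((one_lt_inv₀ hε).2 hε1).le
    have h2 : 0 ≤ ε⁻¹ ^ 2 * Real.log ε⁻¹ := by positivity
    linarith
  · obtain ⟨m, hm, hlog⟩ := exists_card_le_two_pow hK
    exact ⟨m + 1, hlog, hasNonSteinerTreeCover_two T K (Finset.card_pos.1 (by omega)) hm⟩
  · have hn' : (1 : ℝ) ≤ n := by exact_mod_cast hn
    obtain ⟨T, hT⟩ := exists_isWeightedComb (n := n) (M := M) hn (by linarith)
    refine ⟨T, hT, fun β hβ => ?_⟩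
    have := hT.log_le hn hM hβ
    linarith
  · have h1 := unitStar_cover_size (0 : Fin (n + 1)) (by linarith) hβ
    rw [Finset.card_erase_of_mem (Finset.mem_univ _), Finset.card_univ, Fintype.card_fin,
      Nat.add_sub_cancel] at h1
    have h2 : (n : ℝ) ≤ 2 * β := by exact_mod_cast h1
    linarith
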